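/- Let $f_0,f_1:\mathbb{R}^2\to\mathbb{R}^2$ be real-analytic vector fields with $f_0(0)=f_1(0)=0$, each globally asymptotically stable (GAS) at the origin: the solutions of $\dot x=f_i(x)$ exist for all $t\ge 0$, the origin is stable, and every solution converges to $0$ as $t\to+\infty$. Let $V:\mathbb{R}^2\to\mathbb{R}$ be a real-analytic common weak Lyapunov function, i.e. $V(0)=0$, $V(x)>0$ for $x\neq 0$, and $L_{f_i}V(x)=\mathrm{d}V(x)\cdot f_i(x)\le 0$ for all $x$ and $i=0,1$. Assume that $V$ is radially unbounded ($V(x)\to+\infty$ as $\|x\|\to+\infty$) and that $\mathrm{d}V(x)=0$ only at $x=0$. An input is a piecewise constant, right-continuous function $u:[0,+\infty)\to\{0,1\}$ with finitely many switches on every bounded interval, and $\Phi_u(t,x)$ denotes the solution of $\dot x=f_{u(t)}(x)$ starting at $x$. The switched system $\dot x=(1-u)f_0(x)+uf_1(x)$, $u\in\{0,1\}$, is globally uniformly asymptotically stable (GUAS) at the origin if $\Phi_u(t,x)$ is defined for all $t\ge0$, all $x$ and all inputs $u$, and - for every $\delta>0$ there is $\varepsilon>0$ such that $\|x\|\le\varepsilon$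 implies $\|\Phi_u(t,x)\|\le\delta$ for all inputs $u$ and all $t\ge 0$; and - for all $\varepsilon,\delta>0$ there is $T>0$ such that $\|x\|\le\delta$ implies $\|\Phi_u(t,x)\|\le\varepsilon$ for all inputs $u$ and all $t\ge T$. Let $\mathcal{Z}=\{x\in\mathbb{R}^2:\det(f_0(x),f_1(x))=0\}$ and $\mathcal{K}=\{x\in\mathbb{R}^2: L_{f_0}V(x)=0 \text{ and } L_{f_1}V(x)=0\}$. Then the following statements are equivalent: 1. the switched system is GUAS at the origin; 2. the set $\{x\in\mathcal{Z}:\langle f_0(x),f_1(x)\rangle<0\}$ is empty; 3. the set $\{x\in\mathcal{K}:\langle f_0(x),f_1(x)\rangle<0\}$ is empty. -/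

import Mathlib

open Set Filter Topology

namespace Switched

/-- The Euclidean plane `ℝ²`. -/
abbrev Plane : Type := EuclideanSpace ℝ (Fin 2)

section General

variable {ι E : Type*} [NormedAddCommGroup E] [NormedSpace ℝ E]

/-- `φ` restricted to `[0, +∞)` is a solution of `ẋ = F t x`, `x(0) = x₀`: it is continuous on
`[0, +∞)` and its right derivative at every `t ≥ 0` is `F t (φ t)`. When `F` is right-continuous
and piecewise constant in `t` and continuous in `x`, these are exactly the continuous functions
that are `C¹` and satisfy the equation on each of the intervals where `F` does not depend on `t`. -/
def IsForwardSolution (F : ℝ → E → E) (x₀ : E) (φ : ℝ → E) : Prop :=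
  φ 0 = x₀ ∧ ContinuousOn φ (Ici 0) ∧
    ∀ t : ℝ, 0 ≤ t → HasDerivWithinAt φ (F t (φ t)) (Ici t) t

/-- Global asymptotic stability at the origin of a single vector field `g`: the solutions of
`ẋ = g x` exist on `[0, +∞)`, the origin is stable, and all solutions converge to the origin. -/
structure IsGAS (g : E → E) : Prop where
  complete : ∀ x : E, ∃ φ : ℝ → E, IsForwardSolution (fun _ => g) x φ
  stable : ∀ δ : ℝ, 0 < δ → ∃ ε : ℝ, 0 < ε ∧ ∀ x : E, ‖x‖ ≤ ε →
    ∀ φ : ℝ → E, IsForwardSolution (fun _ => g) x φ → ∀ t : ℝ, 0 ≤ t → ‖φ t‖ ≤ δ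
  attractive : ∀ (x : E) (φ : ℝ → E), IsForwardSolution (fun _ => g) x φ →
    Tendsto φ atTop (𝓝 0)

/-- `u`, restricted to `[0, +∞)`, is a switching signal: piecewise constant and right-continuous,
with switching times `0 = a₀ < a₁ < ⋯` that tend to `+∞`. (A signal with finitely many switches
also has this form, since `u` need not jump at each `aₙ`.) -/
def IsSwitchingSignal (u : ℝ → ι) : Prop :=
  ∃ a : ℕ → ℝ, a 0 = 0 ∧ StrictMono a ∧ Tendsto a atTop atTop ∧
    ∀ (n : ℕ) (t : ℝ), t ∈ Ico (a n) (a (n + 1)) → u t = u (a n)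

/-- `φ` is the trajectory `t ↦ Φ_u(t, x)`, `t ≥ 0`, of the switched system `ẋ = f_{u(t)}(x)`. -/
def IsTrajectory (f : ι → E → E) (u : ℝ → ι) (x : E) (φ : ℝ → E) : Prop :=
  IsForwardSolution (fun t => f (u t)) x φ

/-- Global uniform asymptotic stability (GUAS) at the origin of the switched system defined by
the family `f`: trajectories exist on `[0, +∞)` for all inputs, and the origin is uniformly stable
and globally uniformly attractive, uniformly over all switching signals. -/
structure IsGUAS (f : ι → E → E) : Prop where
  complete : ∀ u : ℝ → ι, IsSwitchingSignal u → ∀ x : E, ∃ φ : ℝ → E, IsTrajectory f u x φ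
  stable : ∀ δ : ℝ, 0 < δ → ∃ ε : ℝ, 0 < ε ∧ ∀ x : E, ‖x‖ ≤ ε →
    ∀ u : ℝ → ι, IsSwitchingSignal u → ∀ φ : ℝ → E, IsTrajectory f u x φ →
      ∀ t : ℝ, 0 ≤ t → ‖φ t‖ ≤ δ
  attractive : ∀ ε δ : ℝ, 0 < ε → 0 < δ → ∃ T : ℝ, 0 < T ∧ ∀ x : E, ‖x‖ ≤ δ →
    ∀ u : ℝ → ι, IsSwitchingSignal u → ∀ φ : ℝ → E, IsTrajectory f u x φ →
      ∀ t : ℝ, T ≤ t → ‖φ t‖ ≤ ε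

/-- The Lie derivative of `V` along `g` at `x`. -/
noncomputable def lieDeriv (g : E → E) (V : E → ℝ) (x : E) : ℝ :=
  fderiv ℝ V x (g x)

/-- `V` is a (common) weak Lyapunov function of the family `f`: it is positive definite and its
Lie derivative along each `f i` is nonpositive. (Its regularity is stated separately.) -/
structure IsWeakLyapunov (f : ι → E → E) (V : E → ℝ) : Prop where
  zero : V 0 = 0
  pos : ∀ x : E, x ≠ 0 → 0 < V x
  lie_nonpos : ∀ (i : ι) (x : E), lieDeriv (f i) V x ≤ 0

/-- The set where the vector field `g` is tangent to the level sets of `V`. -/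
def tangencySet (g : E → E) (V : E → ℝ) : Set E :=
  {x | lieDeriv g V x = 0}

end General

/-- The set where two planar vector fields are collinear: `det (g x, h x) = 0`. -/
def collinearSet (g h : Plane → Plane) : Set Plane :=
  {x | Matrix.det !![g x 0, h x 0; g x 1, h x 1] = 0}

end Switched

namespace Switched

/-! ### Forward solutions, monotonicity of `V`, concatenation along a signal. -/

section Forward

variable {ι E : Type*} [NormedAddCommGroup E] [NormedSpace ℝ E]

/-! If the fields are opposite at some `x`, fast switching with suitable time ratios averages them
to zero there. By Gronwall the trajectory stays near `x` for any prescribed time, contradicting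
uniform attraction (`exists_trajectory_near`).

Conversely, let `p ≠ 0`. The fields are nonzero at `p` by GAS and not opposite, so both point into
one open half-plane, and every trajectory near `p` drifts away at a speed independent of the input.
Since `dV ≠ 0`, level sets of `V` are analytic curves. A Lie derivative vanishing on an arc through
`p` would trap the solution of that field in its level set forever, contradicting GAS; so its zeros
on the curve are isolated (`eventually_lieDeriv_ne_zero`). After drifting off `p`, a trajectory is
thus either well below the level of `p` or strictly decreasing `V` (`exists_local_decrease`).
Compactness of the shells `m ≤ V ≤ M` makes the decrease uniform (`isGUAS_of_local_decrease`).

The last two conditions agree because the kernel of `dV x ≠ 0` is a line, while opposite fields have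
Lie derivatives of opposite signs, which must then both vanish. -/

theorem IsForwardSolution.shift {F : ℝ → E → E} {x : E} {φ : ℝ → E}
    (h : IsForwardSolution F x φ) {s : ℝ} (hs : 0 ≤ s) :
    IsForwardSolution (fun t => F (t + s)) (φ s) (fun t => φ (t + s)) := by
  obtain ⟨-, hc, hd⟩ := h
  refine ⟨by simp, ?_, fun t ht => ?_⟩
  · exact hc.comp (by fun_prop) fun t (ht : 0 ≤ t) => add_nonneg ht hs
  · have h1 := hd (t + s) (by positivity)
    have h2 : HasDerivWithinAt (fun t : ℝ => t + s) 1 (Ici t) t :=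
      ((hasDerivAt_id t).add_const s).hasDerivWithinAt
    simpa [Function.comp_def] using
      h1.scomp t h2 (fun r (hr : t ≤ r) => show t + s ≤ r + s by linarith)

theorem IsForwardSolution.hasDerivWithinAt_comp {F : ℝ → E → E} {x : E} {φ : ℝ → E}
    (h : IsForwardSolution F x φ) {V : E → ℝ} (hV : Differentiable ℝ V) {t : ℝ} (ht : 0 ≤ t) :
    HasDerivWithinAt (fun t => V (φ t)) (lieDeriv (F t) V (φ t)) (Ici t) t :=
  (hV (φ t)).hasFDerivAt.comp_hasDerivWithinAt t (h.2.2 t ht)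

/-- A function whose right derivative is at most `m` grows at most linearly with slope `m`. -/
theorem le_add_mul_of_deriv_right_le {w w' : ℝ → ℝ} {a b m : ℝ} (hab : a ≤ b)
    (hw : ContinuousOn w (Icc a b))
    (hw' : ∀ t ∈ Ico a b, HasDerivWithinAt w (w' t) (Ici t) t)
    (hm : ∀ t ∈ Ico a b, w' t ≤ m) : w b ≤ w a + m * (b - a) := by
  have h := image_le_of_deriv_right_le_deriv_boundary (B := fun t => w a + m * (t - a))
    (B' := fun _ => m) hw hw' (by simp) (by fun_prop) (fun t _ => ?_) hm
  · exact h (right_mem_Icc.2 hab)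
  · simpa using (((hasDerivAt_id t).sub_const a).const_mul m).const_add (w a) |>.hasDerivWithinAt

/-- Switching times offer only right derivatives, hence the one-sided mean value inequality, with
slope `0`. -/
theorem IsForwardSolution.antitoneOn {F : ℝ → E → E} {x : E} {φ : ℝ → E}
    (h : IsForwardSolution F x φ) {V : E → ℝ} (hV : Differentiable ℝ V)
    (hF : ∀ t y, lieDeriv (F t) V y ≤ 0) : AntitoneOn (fun t => V (φ t)) (Ici 0) := by
  intro a (ha : 0 ≤ a) b _ hab
  have := le_add_mul_of_deriv_right_le (w := fun t => V (φ t)) (m := 0) hab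
    (hV.continuous.comp_continuousOn (h.2.1.mono fun t ht => ha.trans ht.1))
    (fun t ht => h.hasDerivWithinAt_comp hV (ha.trans ht.1)) (fun t _ => hF _ _)
  simpa using this

theorem IsTrajectory.antitoneOn {f : ι → E → E} {u : ℝ → ι} {x : E} {φ : ℝ → E}
    (h : IsTrajectory f u x φ) {V : E → ℝ} (hV : Differentiable ℝ V)
    (hL : IsWeakLyapunov f V) : AntitoneOn (fun t => V (φ t)) (Ici 0) :=
  IsForwardSolution.antitoneOn h hV fun _ => hL.lie_nonpos _

theorem IsWeakLyapunov.nonneg {f : ι → E → E} {V : E → ℝ} (hL : IsWeakLyapunov f V) (x : E) :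
    0 ≤ V x := by
  rcases eq_or_ne x 0 with rfl | hx
  · exact hL.zero.ge
  · exact (hL.pos x hx).le

/-- A globally asymptotically stable vector field has no equilibrium besides the origin. -/
theorem IsGAS.ne_zero {g : E → E} (hg : IsGAS g) {x : E} (hx : x ≠ 0) : g x ≠ 0 := by
  intro h
  have := hg.attractive x (fun _ => x)
    ⟨rfl, continuousOn_const, fun t _ => by simpa [h] using hasDerivWithinAt_const t (Ici t) x⟩
  exact hx (tendsto_nhds_unique tendsto_const_nhds this)

/-- Solutions of the members of the family can be concatenated along a switching signal. -/
theorem exists_isTrajectory {f : ι → E → E}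
    (hf : ∀ i x, ∃ φ : ℝ → E, IsForwardSolution (fun _ => f i) x φ)
    {u : ℝ → ι} (hu : IsSwitchingSignal u) (x : E) : ∃ φ : ℝ → E, IsTrajectory f u x φ := by
  obtain ⟨a, ha0, hmono, hlim, hua⟩ := hu
  choose S hS using hf
  let X : ℕ → E := fun n => Nat.rec x (fun n y => S (u (a n)) y (a (n + 1) - a n)) n
  let ψ : ℕ → ℝ → E := fun n t => S (u (a n)) (X n) (t - a n)
  have hψ0 : ∀ n, ψ n (a n) = X n := fun n => by simpa [ψ] using (hS (u (a n)) (X n)).1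
  have hψ1 : ∀ n, ψ n (a (n + 1)) = X (n + 1) := fun n => rfl
  have hψd : ∀ n t, a n ≤ t → HasDerivWithinAt (ψ n) (f (u (a n)) (ψ n t)) (Ici t) t := by
    intro n t ht
    have h1 := (hS (u (a n)) (X n)).2.2 (t - a n) (by linarith)
    have h2 : HasDerivWithinAt (fun t : ℝ => t - a n) 1 (Ici t) t :=
      ((hasDerivAt_id t).sub_const _).hasDerivWithinAt
    simpa [Function.comp_def] using
      h1.scomp t h2 (fun r (hr : t ≤ r) => show t - a n ≤ r - a n by linarith)
  have hψc : ∀ n, ContinuousOn (ψ n) (Ici (a n)) := fun n =>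
    (hS (u (a n)) (X n)).2.1.comp (by fun_prop) fun t (ht : a n ≤ t) => sub_nonneg.2 ht
  have hex : ∀ t, ∃ n, t < a (n + 1) := fun t =>
    ((hlim.comp (tendsto_add_atTop_nat 1)).eventually_gt_atTop t).exists
  classical
  let φ : ℝ → E := fun t => ψ (Nat.find (hex t)) t
  have hφ : ∀ n t, t ∈ Ico (a n) (a (n + 1)) → φ t = ψ n t := by
    intro n t ht
    have : Nat.find (hex t) = n := (Nat.find_eq_iff _).2
      ⟨ht.2, fun k hk => not_lt.2 ((hmono.monotone (Nat.succ_le_of_lt hk)).trans ht.1)⟩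
    simp only [φ, this]
  have hφ' : ∀ n t, t ∈ Icc (a n) (a (n + 1)) → φ t = ψ n t := by
    intro n t ht
    rcases ht.2.lt_or_eq with h | rfl
    · exact hφ n t ⟨ht.1, h⟩
    · rw [hψ1, hφ (n + 1) _ ⟨le_rfl, hmono (Nat.lt_succ_self _)⟩, hψ0]
  have hIco : ∀ t, 0 ≤ t → ∃ n, t ∈ Ico (a n) (a (n + 1)) := by
    intro t ht
    refine ⟨Nat.find (hex t), ?_, Nat.find_spec (hex t)⟩
    rcases h : Nat.find (hex t) with _ | k
    · rwa [ha0]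
    · exact not_lt.1 (Nat.find_min (hex t) (by omega : k < _))
  have hder : ∀ t, 0 ≤ t → HasDerivWithinAt φ (f (u t) (φ t)) (Ici t) t := by
    intro t ht
    obtain ⟨n, hn⟩ := hIco t ht
    rw [hφ n t hn, hua n t hn]
    refine (hψd n t hn.1).congr_of_eventuallyEq ?_ (hφ n t hn)
    filter_upwards [self_mem_nhdsWithin, nhdsWithin_le_nhds (Iio_mem_nhds hn.2)] with s hs hs'
    exact hφ n s ⟨hn.1.trans hs, hs'⟩
  refine ⟨φ, ?_, fun t ht => ?_, hder⟩
  · rw [hφ 0 0 ⟨ha0.le, by simpa [ha0] using hmono Nat.zero_lt_one⟩]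
    simpa [ha0, X] using hψ0 0
  rcases eq_or_lt_of_le (show 0 ≤ t from ht) with rfl | ht
  · exact (hder 0 le_rfl).continuousWithinAt
  refine (continuousAt_iff_continuous_left_right.2
    ⟨?_, (hder t ht.le).continuousWithinAt⟩).continuousWithinAt
  -- Left continuity needs the interval closed on the right, since `t` may itself be a switching
  -- time.
  obtain ⟨n, hn, hn'⟩ : ∃ n, a n < t ∧ t ≤ a (n + 1) := by
    have hex' : ∃ n, t ≤ a (n + 1) := (hex t).imp fun _ => le_of_lt
    refine ⟨Nat.find hex', ?_, Nat.find_spec hex'⟩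
    rcases h : Nat.find hex' with _ | k
    · rwa [ha0]
    · exact not_le.1 (Nat.find_min hex' (by omega : k < _))
  have h1 : ContinuousWithinAt (ψ n) (Iic t) t :=
    ((hψc n).continuousAt (Ici_mem_nhds hn)).continuousWithinAt
  refine h1.congr_of_eventuallyEq ?_ (hφ' n t ⟨hn.le, hn'⟩)
  filter_upwards [self_mem_nhdsWithin, nhdsWithin_le_nhds (Ioi_mem_nhds hn)] with s hs hs'
  exact hφ' n s ⟨(show a n < s from hs').le, (show s ≤ t from hs).trans hn'⟩

end Forward

/-! ### Analytic functions on level curves of `V`; isolated zeros of the Lie derivative. -/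

/-- Near a regular point of `V`, there are analytic coordinates the second of which is `V`. -/
theorem exists_chart {V : Plane → ℝ} {p : Plane} (hV : AnalyticAt ℝ V p)
    (hp : fderiv ℝ V p ≠ 0) :
    ∃ e : OpenPartialHomeomorph Plane (ℝ × ℝ), p ∈ e.source ∧ (∀ y, (e y).2 = V y) ∧
      AnalyticAt ℝ e.symm (e p) := by
  set D := fderiv ℝ V p with hD
  let x : Plane →L[ℝ] ℝ := EuclideanSpace.proj 0
  let y : Plane →L[ℝ] ℝ := EuclideanSpace.proj 1
  set b0 : Plane := EuclideanSpace.single 0 1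
  set b1 : Plane := EuclideanSpace.single 1 1
  -- `D` rotated by a right angle: `(ℓ, D)` has determinant `-(D b0 ^ 2 + D b1 ^ 2)`.
  let ℓ : Plane →L[ℝ] ℝ := D b0 • y - D b1 • x
  have hdec : ∀ v : Plane, D v = D b0 * v 0 + D b1 * v 1 := by
    intro v
    have : v = v 0 • b0 + v 1 • b1 := by
      ext i; fin_cases i <;> simp [b0, b1]
    conv_lhs => rw [this]
    simp [mul_comm]
  have hpos : 0 < D b0 ^ 2 + D b1 ^ 2 := by
    by_contra h
    have h0 : D b0 = 0 := by nlinarith [sq_nonneg (D b0), sq_nonneg (D b1)]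
    have h1 : D b1 = 0 := by nlinarith [sq_nonneg (D b0), sq_nonneg (D b1)]
    exact hp (by ext v; simp [hdec v, h0, h1])
  have hinj : Function.Injective (ℓ.prod D : Plane →L[ℝ] ℝ × ℝ).toLinearMap := by
    rw [injective_iff_map_eq_zero]
    intro v hv
    have hv1 : D b0 * v 1 - D b1 * v 0 = 0 := congrArg Prod.fst hv
    have hv2 : D b0 * v 0 + D b1 * v 1 = 0 := (hdec v).symm.trans (congrArg Prod.snd hv)
    have h0 : (D b0 ^ 2 + D b1 ^ 2) * v 0 = 0 := by linear_combination D b0 * hv2 - D b1 * hv1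
    have h1 : (D b0 ^ 2 + D b1 ^ 2) * v 1 = 0 := by linear_combination D b1 * hv2 + D b0 * hv1
    ext i; fin_cases i
    · simpa [hpos.ne'] using h0
    · simpa [hpos.ne'] using h1
  let A : Plane ≃L[ℝ] ℝ × ℝ :=
    (LinearMap.linearEquivOfInjective _ hinj (by simp)).toContinuousLinearEquiv
  have hA : (A : Plane →L[ℝ] ℝ × ℝ) = ℓ.prod D := by ext v <;> rfl
  let F : Plane → ℝ × ℝ := fun v => (ℓ v, V v)
  have hFa : AnalyticAt ℝ F p := (ℓ.analyticAt p).prod hV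
  have hF : HasStrictFDerivAt F (A : Plane →L[ℝ] ℝ × ℝ) p := by
    rw [hA]
    exact ℓ.hasStrictFDerivAt.prodMk hV.hasStrictFDerivAt
  refine ⟨hF.toOpenPartialHomeomorph F, hF.mem_toOpenPartialHomeomorph_source, fun v => rfl, ?_⟩
  exact (hF.toOpenPartialHomeomorph F).analyticAt_symm' hF.mem_toOpenPartialHomeomorph_source
    hFa hF.hasFDerivAt.fderiv

/-- On the level set of `V` through a regular point, an analytic function either vanishes
identically near that point or has no other zero near it. -/
theorem eventually_ne_zero_or_eq_zero_on_level {V L : Plane → ℝ} {p : Plane}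
    (hV : AnalyticAt ℝ V p) (hp : fderiv ℝ V p ≠ 0) (hL : AnalyticAt ℝ L p) :
    (∀ᶠ y in 𝓝[≠] p, V y = V p → L y ≠ 0) ∨ ∀ᶠ y in 𝓝 p, V y = V p → L y = 0 := by
  obtain ⟨e, hpe, heV, hsymm⟩ := exists_chart hV hp
  have hep : ((e p).1, V p) = e p := by rw [← heV p]
  -- `L` along the level curve is analytic in one variable, so its zeros are isolated or fill a
  -- neighbourhood.
  have hh : AnalyticAt ℝ (fun s : ℝ => L (e.symm (s, V p))) (e p).1 := by
    have h1 : AnalyticAt ℝ (L ∘ e.symm) (e p) :=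
      AnalyticAt.comp (by rwa [e.left_inv hpe]) hsymm
    exact AnalyticAt.fun_comp (f := fun s : ℝ => (s, V p)) (by rwa [hep])
      (analyticAt_id.prod analyticAt_const)
  have hcont : Tendsto (fun y => (e y).1) (𝓝 p) (𝓝 (e p).1) :=
    continuous_fst.continuousAt.comp (e.continuousAt hpe)
  have hy : ∀ y ∈ e.source, V y = V p → e.symm ((e y).1, V p) = y := by
    intro y hys hyV
    rw [← hyV, ← heV y]
    exact e.left_inv hys
  rcases hh.eventually_eq_zero_or_eventually_ne_zero with h | h
  · right
    filter_upwards [hcont.eventually h, e.open_source.mem_nhds hpe] with y h1 h2 h3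
    rwa [hy y h2 h3] at h1
  · left
    rw [eventually_nhdsWithin_iff] at h ⊢
    filter_upwards [hcont.eventually h, e.open_source.mem_nhds hpe] with y h1 h2 hyp h3
    rw [hy y h2 h3] at h1
    refine h1 fun h4 => hyp ?_
    refine e.injOn h2 hpe (Prod.ext h4 ?_)
    rw [heV, heV, h3]

/-- A smooth function that vanishes on the level set of `V` through a regular point is locally
dominated by the variation of `V`. -/
theorem exists_abs_le_mul_abs_sub_of_eq_zero_on_level {V L : Plane → ℝ} {p : Plane}
    (hV : AnalyticAt ℝ V p) (hp : fderiv ℝ V p ≠ 0) (hL : AnalyticAt ℝ L p)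
    (h0 : ∀ᶠ y in 𝓝 p, V y = V p → L y = 0) :
    ∃ K : ℝ, ∀ᶠ y in 𝓝 p, |L y| ≤ K * |V y - V p| := by
  obtain ⟨e, hpe, heV, hsymm⟩ := exists_chart hV hp
  have hG : AnalyticAt ℝ (L ∘ e.symm) (e p) :=
    AnalyticAt.comp (by rwa [e.left_inv hpe]) hsymm
  obtain ⟨K, s, hs, hK⟩ := (hG.contDiffAt (n := 1)).exists_lipschitzOnWith
  have hcont : Tendsto e (𝓝 p) (𝓝 (e p)) := e.continuousAt hpe
  -- In the chart, `y` is projected onto the level curve, where `L` vanishes; the Lipschitz bound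
  -- then compares the two points.
  have hproj : Tendsto (fun y => ((e y).1, V p)) (𝓝 p) (𝓝 (e p)) := by
    have : Tendsto (fun y => ((e y).1, V p)) (𝓝 p) (𝓝 ((e p).1, V p)) :=
      (continuous_fst.continuousAt.tendsto.comp hcont).prodMk_nhds tendsto_const_nhds
    rwa [show ((e p).1, V p) = e p by rw [← heV p]] at this
  have hback : Tendsto e.symm (𝓝 (e p)) (𝓝 p) := by
    have := e.continuousAt_symm (e.map_source hpe)
    rwa [ContinuousAt, e.left_inv hpe] at this
  refine ⟨K, ?_⟩
  filter_upwards [hcont.eventually hs, hproj.eventually hs, e.open_source.mem_nhds hpe,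
    hproj.eventually (e.open_target.mem_nhds (e.map_source hpe)),
    (hback.comp hproj).eventually h0] with y h1 h2 h3 h4 h5
  have h6 : L (e.symm ((e y).1, V p)) = 0 := by
    refine h5 ?_
    change V (e.symm ((e y).1, V p)) = V p
    rw [← heV (e.symm _), e.right_inv h4]
  have h7 := hK.dist_le_mul _ h1 _ h2
  simp only [Function.comp_apply, e.left_inv h3, h6, Real.dist_eq, sub_zero] at h7
  refine h7.trans_eq ?_
  rw [Prod.dist_eq, dist_self, Real.dist_eq, heV, max_eq_right (abs_nonneg _)]

/-- The Lie derivative of an analytic positive definite proper function along a globally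
asymptotically stable analytic vector field has isolated zeros on the level sets. -/
theorem eventually_lieDeriv_ne_zero {g : Plane → Plane} {V : Plane → ℝ}
    (hg : AnalyticOnNhd ℝ g univ) (hGAS : IsGAS g) (hV : AnalyticOnNhd ℝ V univ)
    (hV0 : V 0 = 0) (hVpos : ∀ x, x ≠ 0 → 0 < V x) (hlie : ∀ x, lieDeriv g V x ≤ 0)
    (hdV : ∀ x, fderiv ℝ V x = 0 → x = 0) {p : Plane} (hp : p ≠ 0) :
    ∀ᶠ y in 𝓝[≠] p, V y = V p → lieDeriv g V y ≠ 0 := by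
  have hVd : Differentiable ℝ V := fun x => (hV x (mem_univ x)).differentiableAt
  have hLa : ∀ x, AnalyticAt ℝ (lieDeriv g V) x := fun x =>
    ((ContinuousLinearMap.id ℝ (Plane →L[ℝ] ℝ)).analyticAt_bilinear (_, _)).comp₂
      (hV.fderiv x (mem_univ x)) (hg x (mem_univ x))
  refine (eventually_ne_zero_or_eq_zero_on_level (hV p (mem_univ p)) (mt (hdV p) hp)
    (hLa p)).resolve_right fun hzero => ?_
  obtain ⟨γ, hγ⟩ := hGAS.complete p
  have hanti := hγ.antitoneOn hVd fun _ => hlie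
  have hcont : ContinuousOn (fun t => V (γ t)) (Ici 0) :=
    hVd.continuous.comp_continuousOn hγ.2.1
  have hne : ∀ t, V (γ t) = V p → γ t ≠ 0 := by
    intro t ht h
    rw [h, hV0] at ht
    exact (hVpos p hp).ne ht
  -- Continuous induction: the times spent on the level set form a closed set that can always be
  -- extended to the right.
  have hconst : ∀ T, 0 ≤ T → V (γ T) = V p := by
    intro T hT
    have hclosed : IsClosed ({t | V (γ t) = V p} ∩ Icc 0 T) := by
      have : ContinuousOn (fun t => V (γ t)) (Icc 0 T) := hcont.mono fun t ht => ht.1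
      rw [inter_comm]
      exact this.preimage_isClosed_of_isClosed isClosed_Icc (isClosed_singleton (x := V p))
    refine hclosed.Icc_subset_of_forall_mem_nhdsWithin (by simp [hγ.1]) ?_ (right_mem_Icc.2 hT)
    rintro t ⟨ht, ht0, -⟩
    replace ht : V (γ t) = V p := ht
    have hq := hne t ht
    have hzero' : ∀ᶠ y in 𝓝 (γ t), V y = V (γ t) → lieDeriv g V y = 0 := by
      rcases ht0.eq_or_lt with rfl | ht0
      · rwa [hγ.1]
      -- The arc travelled so far consists of zeros of the Lie derivative. An isolated zero at `γ t`
      -- would make `γ` constant just before `t`, hence `γ t` an equilibrium.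
      refine (eventually_ne_zero_or_eq_zero_on_level (hV _ (mem_univ _)) (mt (hdV _) hq)
        (hLa _)).resolve_left fun hiso => ?_
      have hVr : ∀ r ∈ Icc 0 t, V (γ r) = V p := by
        intro r hr
        refine le_antisymm ?_ ?_
        · simpa [hγ.1] using hanti (mem_Ici.2 le_rfl) (mem_Ici.2 hr.1) hr.1
        · exact ht.ge.trans (hanti (mem_Ici.2 hr.1) (mem_Ici.2 ht0.le) hr.2)
      have hLr : ∀ r ∈ Ico 0 t, lieDeriv g V (γ r) = 0 := by
        intro r hr
        have h1 := hγ.hasDerivWithinAt_comp hVd hr.1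
        have h2 : HasDerivWithinAt (fun t => V (γ t)) 0 (Ici r) r := by
          refine (hasDerivWithinAt_const r (Ici r) (V p)).congr_of_eventuallyEq ?_
            (hVr r ⟨hr.1, hr.2.le⟩)
          filter_upwards [self_mem_nhdsWithin, nhdsWithin_le_nhds (Iio_mem_nhds hr.2)]
            with s hs hs'
          exact hVr s ⟨hr.1.trans hs, (show s < t from hs').le⟩
        exact (uniqueDiffWithinAt_Ici r).eq_deriv _ h1 h2
      rw [eventually_nhdsWithin_iff] at hiso
      have hct : ContinuousAt γ t := hγ.2.1.continuousAt (Ici_mem_nhds ht0)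
      have hev : ∀ᶠ r in 𝓝 t, r < t → γ r = γ t := by
        filter_upwards [hct.eventually hiso, Ioi_mem_nhds ht0] with r h1 h2 h3
        by_contra h4
        exact h1 h4 ((hVr r ⟨le_of_lt h2, h3.le⟩).trans ht.symm) (hLr r ⟨le_of_lt h2, h3⟩)
      obtain ⟨r, hrt, hr⟩ :=
        ((eventually_eventually_nhds.2 hev).and (Ioi_mem_nhds ht0)).filter_mono
          (nhdsWithin_le_nhds (s := Iio t)) |>.and self_mem_nhdsWithin |>.exists
      have hr' : r < t := hr
      have h1 : HasDerivWithinAt γ (g (γ r)) (Ici r) r := hγ.2.2 r (le_of_lt hrt.2)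
      have h2 : HasDerivWithinAt γ 0 (Ici r) r := by
        refine (hasDerivWithinAt_const r (Ici r) (γ t)).congr_of_eventuallyEq ?_
          (hrt.1.self_of_nhds hr')
        filter_upwards [nhdsWithin_le_nhds hrt.1, nhdsWithin_le_nhds (Iio_mem_nhds hr')]
          with s hs hs'
        exact hs hs'
      have h3 := (uniqueDiffWithinAt_Ici r).eq_deriv _ h1 h2
      rw [hrt.1.self_of_nhds hr'] at h3
      exact hGAS.ne_zero hq h3
    obtain ⟨K, hK⟩ := exists_abs_le_mul_abs_sub_of_eq_zero_on_level (hV _ (mem_univ _))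
      (mt (hdV _) hq) (hLa _) hzero'
    have hct : Tendsto γ (𝓝[≥] t) (𝓝 (γ t)) := (hγ.2.2 t ht0).continuousWithinAt
    obtain ⟨b, hb, hbK⟩ := (mem_nhdsGE_iff_exists_Ico_subset).1 (hct.eventually hK)
    refine mem_of_superset (Ioo_mem_nhdsGT hb) fun s hs => ?_
    -- Gronwall: `V ∘ γ - V p` starts at zero and its derivative is at most `K` times itself in
    -- absolute value.
    have := eq_zero_of_abs_deriv_le_mul_abs_self_of_eq_zero_right
      (f := fun t => V (γ t) - V p) (f' := fun t => lieDeriv g V (γ t)) (K := K) (a := t) (b := s)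
      ((hcont.mono fun r hr => ht0.trans hr.1).sub continuousOn_const)
      (fun r hr => (hγ.hasDerivWithinAt_comp hVd (ht0.trans hr.1)).sub_const _)
      (by simp [ht])
      (fun r hr => by simpa [ht] using hbK (⟨hr.1, hr.2.trans hs.2⟩ : r ∈ Ico t b))
      s (right_mem_Icc.2 hs.1.le)
    exact sub_eq_zero.1 this
  have hlim : Tendsto (fun t => V (γ t)) atTop (𝓝 (V 0)) :=
    (hVd.continuous.tendsto 0).comp (hGAS.attractive p γ hγ)
  have hlim' : Tendsto (fun t => V (γ t)) atTop (𝓝 (V p)) :=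
    tendsto_const_nhds.congr' <| (eventually_ge_atTop 0).mono fun t ht => (hconst t ht).symm
  have := tendsto_nhds_unique hlim hlim'
  exact (hVpos p hp).ne (hV0.symm.trans this)

/-! ### Uniform decrease of `V` near a point and on compact sets. -/

section Decrease

variable {ι : Type*} {f : ι → Plane → Plane} {V : Plane → ℝ}

/-- If the vector fields point into a common open half-plane at `p` and, near `p`, their Lie
derivatives do not vanish on the level set through `p` except possibly at `p`, then along the
trajectories issued from a neighbourhood of `p`, `V` decreases by a fixed amount in a fixed time. -/
theorem exists_local_decrease [Finite ι] (hf : ∀ i, Continuous (f i)) (hV : ContDiff ℝ 1 V)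
    (hL : ∀ i x, lieDeriv (f i) V x ≤ 0) {p w : Plane} (hw : ∀ i, 0 < inner ℝ w (f i p))
    (hiso : ∀ i, ∀ᶠ y in 𝓝[≠] p, V y = V p → lieDeriv (f i) V y ≠ 0) :
    ∃ U ∈ 𝓝 p, ∃ τ : ℝ, 0 < τ ∧ ∃ η : ℝ, 0 < η ∧ ∀ x ∈ U, ∀ (u : ℝ → ι) (φ : ℝ → Plane),
      IsTrajectory f u x φ → V (φ τ) ≤ V x - η := by
  have hVd : Differentiable ℝ V := hV.differentiable one_ne_zero
  have hLc : ∀ i, Continuous (lieDeriv (f i) V) := fun i =>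
    (hV.continuous_fderiv one_ne_zero).clm_apply (hf i)
  obtain ⟨κ, hκ, hκ0⟩ : ∃ κ : ℝ, (∀ i, κ < inner ℝ w (f i p)) ∧ 0 < κ :=
    (((eventually_all.2 fun i => Iio_mem_nhds (hw i)).filter_mono
      (nhdsWithin_le_nhds (s := Ioi 0))).and self_mem_nhdsWithin).exists
  obtain ⟨M, hM, hM0⟩ : ∃ M : ℝ, (∀ i, ‖f i p‖ < M) ∧ 0 < M :=
    ((eventually_all.2 fun i => eventually_gt_atTop ‖f i p‖).and (eventually_gt_atTop 0)).exists
  have hev : ∀ᶠ y in 𝓝 p, (∀ i, κ < inner ℝ w (f i y)) ∧ (∀ i, ‖f i y‖ < M) ∧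
      ∀ i, y ≠ p → V y = V p → lieDeriv (f i) V y ≠ 0 := by
    refine (eventually_all.2 fun i => ?_).and ((eventually_all.2 fun i => ?_).and
      (eventually_all.2 fun i => eventually_nhdsWithin_iff.1 (hiso i)))
    · exact (continuous_const.inner (hf i)).continuousAt.eventually (Ioi_mem_nhds (hκ i))
    · exact (hf i).norm.continuousAt.eventually (Iio_mem_nhds (hM i))
  obtain ⟨r, hr0, hr⟩ := Metric.nhds_basis_closedBall.mem_iff.1 hev
  -- Starting within `r / 2` of `p` at speed below `M`, a trajectory stays in the ball of radius `r`
  -- up to time `τ`.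
  set τ := r / (2 * M) with hτ
  have hτ0 : 0 < τ := by positivity
  have hτM : M * τ = r / 2 := by rw [hτ]; field_simp
  -- `Q` excludes `p`. By time `τ / 2` the drift along `w` is at least `κ * τ / 2`, of which the
  -- initial offset costs less than `κ * τ / 4`.
  let Q : Set Plane := Metric.closedBall p r ∩ {y | κ * τ / 4 ≤ inner ℝ w (y - p)}
  have hQ : IsCompact Q := (isCompact_closedBall p r).inter_right <|
    isClosed_le continuous_const (continuous_const.inner (continuous_id.sub continuous_const))
  have hm : ∀ i, ∃ m : ℝ, 0 < m ∧ ∀ y ∈ Q, lieDeriv (f i) V y ≤ -m ∨ m ≤ |V y - V p| := by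
    intro i
    have hc : Continuous fun y => max (-lieDeriv (f i) V y) |V y - V p| := by
      have := hLc i
      have := hVd.continuous
      fun_prop
    rcases Q.eq_empty_or_nonempty with hQe | hQn
    · exact ⟨1, one_pos, by simp [hQe]⟩
    obtain ⟨y, hyQ, hy⟩ := hQ.exists_isMinOn hQn hc.continuousOn
    refine ⟨max (-lieDeriv (f i) V y) |V y - V p|, ?_, fun z hz => ?_⟩
    · rcases eq_or_ne (V y) (V p) with h | h
      · refine lt_max_of_lt_left (neg_pos.2 ((hL i y).lt_of_ne ((hr hyQ.1).2.2 i ?_ h)))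
        rintro rfl
        have := hyQ.2
        simp only [mem_ofPred_eq, sub_self, inner_zero_right] at this
        have : 0 < κ * τ / 4 := by positivity
        linarith
      · exact lt_max_of_lt_right (abs_pos.2 (sub_ne_zero.2 h))
    · rcases le_max_iff.1 (isMinOn_iff.1 hy z hz) with h | h
      · left; linarith
      · right; exact h
  choose m hm0 hm using hm
  obtain ⟨m', hm', hm'0⟩ : ∃ m' : ℝ, (∀ i, m' < m i) ∧ 0 < m' :=
    (((eventually_all.2 fun i => Iio_mem_nhds (hm0 i)).filter_mono
      (nhdsWithin_le_nhds (s := Ioi 0))).and self_mem_nhdsWithin).exists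
  have hU : ∀ᶠ x in 𝓝 p, ‖x - p‖ < r / 2 ∧ ‖w‖ * ‖x - p‖ < κ * τ / 4 ∧
      |V x - V p| < m' / 2 := by
    have h1 : Tendsto (fun x => ‖x - p‖) (𝓝 p) (𝓝 0) := by
      have : Continuous fun x : Plane => ‖x - p‖ := by fun_prop
      simpa using this.tendsto p
    have h2 : Tendsto (fun x => ‖w‖ * ‖x - p‖) (𝓝 p) (𝓝 0) := by simpa using h1.const_mul ‖w‖
    have h3 : Tendsto (fun x => |V x - V p|) (𝓝 p) (𝓝 0) := by
      have : Continuous fun x : Plane => |V x - V p| := by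
        have := hVd.continuous
        fun_prop
      simpa using this.tendsto p
    exact (h1.eventually (Iio_mem_nhds (by positivity))).and
      ((h2.eventually (Iio_mem_nhds (by positivity))).and
        (h3.eventually (Iio_mem_nhds (by positivity))))
  -- Either `V` falls to `V p - m'` on `[τ / 2, τ]`, a drop of at least `m' / 2` as `V x > V p - m'
  -- / 2`; or it stays within `m'` of `V p`, so its derivative is below `-m'` on that interval.
  refine ⟨_, hU, τ, hτ0, min (m' / 2) (m' * τ / 2), by positivity, ?_⟩
  rintro x ⟨hx1, hx2, hx3⟩ u φ hφ
  rw [abs_lt] at hx3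
  have hφc : ContinuousOn φ (Icc 0 τ) := hφ.2.1.mono fun t ht => ht.1
  have hball : ∀ t ∈ Icc 0 τ, φ t ∈ Metric.closedBall p r := by
    -- The speed bound holds only in the ball. The barrier argument needs it only when `φ` is on the
    -- barrier, which lies in the ball up to `τ`.
    have h := image_norm_le_of_norm_deriv_right_lt_deriv_boundary' (f := fun t => φ t - p)
      (f' := fun t => f (u t) (φ t)) (B := fun t => r / 2 + M * t) (B' := fun _ => M)
      (hφc.sub continuousOn_const) (fun t ht => (hφ.2.2 t ht.1).sub_const p)
      (by simpa [hφ.1] using hx1.le) (by fun_prop)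
      (fun t _ => by
        simpa using (((hasDerivAt_id t).const_mul M).const_add (r / 2)).hasDerivWithinAt)
      (fun t ht hB => ?_)
    · intro t ht
      have h1 : M * t ≤ M * τ := mul_le_mul_of_nonneg_left ht.2 hM0.le
      rw [mem_closedBall_iff_norm]
      linarith [h ht]
    · refine (hr ?_).2.1 (u t)
      have h1 : M * t ≤ M * τ := mul_le_mul_of_nonneg_left ht.2.le hM0.le
      rw [mem_closedBall_iff_norm, hB]
      linarith
  have hQmem : ∀ t ∈ Icc (τ / 2) τ, φ t ∈ Q := by
    intro t ht
    have ht0 : 0 ≤ t := by linarith [ht.1]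
    refine ⟨hball t ⟨ht0, ht.2⟩, ?_⟩
    have h := le_add_mul_of_deriv_right_le (w := fun s => -inner ℝ w (φ s - p))
      (w' := fun s => -inner ℝ w (f (u s) (φ s))) (m := -κ) ht0
      ((continuousOn_const.inner ((hφc.mono (Icc_subset_Icc_right ht.2)).sub
        continuousOn_const)).neg)
      (fun s hs => by
        simpa using ((hasDerivWithinAt_const s (Ici s) w).inner ℝ
          ((hφ.2.2 s hs.1).sub_const p)).fun_neg)
      (fun s hs => neg_le_neg ((hr (hball s ⟨hs.1, hs.2.le.trans ht.2⟩)).1 _).le)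
    simp only [hφ.1, sub_zero] at h
    have h2 : -inner ℝ w (x - p) ≤ ‖w‖ * ‖x - p‖ :=
      (neg_le_abs _).trans (abs_real_inner_le_norm _ _)
    have h3 : κ * (τ / 2) ≤ κ * t := mul_le_mul_of_nonneg_left ht.1 hκ0.le
    simp only [mem_ofPred_eq]
    linarith
  have hanti := IsForwardSolution.antitoneOn hφ hVd fun t => hL (u t)
  have hxV : V (φ 0) = V x := by rw [hφ.1]
  by_cases hlow : ∃ t ∈ Icc (τ / 2) τ, V (φ t) ≤ V p - m'
  · obtain ⟨t, ht, htV⟩ := hlow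
    have h1 : V (φ τ) ≤ V (φ t) :=
      hanti (mem_Ici.2 (by linarith [ht.1])) (mem_Ici.2 hτ0.le) ht.2
    have := min_le_left (m' / 2) (m' * τ / 2)
    linarith
  · push Not at hlow
    have h := le_add_mul_of_deriv_right_le (w := fun s => V (φ s))
      (w' := fun s => lieDeriv (f (u s)) V (φ s)) (m := -m') (by linarith : τ / 2 ≤ τ)
      (hVd.continuous.comp_continuousOn (hφc.mono (Icc_subset_Icc_left (by positivity))))
      (fun s hs => hφ.hasDerivWithinAt_comp hVd (by linarith [hs.1])) (fun s hs => ?_)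
    · have h1 : V (φ (τ / 2)) ≤ V (φ 0) :=
        hanti (mem_Ici.2 le_rfl) (mem_Ici.2 (by positivity)) (by positivity)
      have := min_le_right (m' / 2) (m' * τ / 2)
      have h2 : -m' * (τ - τ / 2) = -(m' * τ / 2) := by ring
      rw [h2] at h
      linarith
    · have hs' : s ∈ Icc (τ / 2) τ := ⟨hs.1, hs.2.le⟩
      rcases hm (u s) _ (hQmem s hs') with h1 | h1
      · linarith [hm' (u s)]
      · exfalso
        have h2 : V (φ s) ≤ V (φ 0) :=
          hanti (mem_Ici.2 le_rfl) (mem_Ici.2 (by linarith [hs.1])) (by linarith [hs.1])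
        have h3 : |V (φ s) - V p| < m' := abs_lt.2 ⟨by linarith [hlow s hs'], by linarith⟩
        linarith [hm' (u s)]

/-- Local decrease estimates around the points of a compact set are uniform on it. -/
theorem exists_decrease_of_isCompact (hV : Differentiable ℝ V)
    (hL : ∀ i x, lieDeriv (f i) V x ≤ 0) {K : Set Plane} (hK : IsCompact K)
    (hloc : ∀ p ∈ K, ∃ U ∈ 𝓝 p, ∃ τ : ℝ, 0 < τ ∧ ∃ η : ℝ, 0 < η ∧ ∀ x ∈ U,
      ∀ (u : ℝ → ι) (φ : ℝ → Plane), IsTrajectory f u x φ → V (φ τ) ≤ V x - η) :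
    ∃ τ : ℝ, 0 < τ ∧ ∃ η : ℝ, 0 < η ∧ ∀ x ∈ K,
      ∀ (u : ℝ → ι) (φ : ℝ → Plane), IsTrajectory f u x φ → V (φ τ) ≤ V x - η := by
  refine hK.induction_on (p := fun s => ∃ τ : ℝ, 0 < τ ∧ ∃ η : ℝ, 0 < η ∧ ∀ x ∈ s,
    ∀ (u : ℝ → ι) (φ : ℝ → Plane), IsTrajectory f u x φ → V (φ τ) ≤ V x - η)
    ⟨1, one_pos, 1, one_pos, by simp⟩ ?_ ?_ ?_
  · rintro s t hst ⟨τ, hτ, η, hη, h⟩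
    exact ⟨τ, hτ, η, hη, fun x hx => h x (hst hx)⟩
  · rintro s t ⟨τ, hτ, η, hη, h⟩ ⟨τ', hτ', η', hη', h'⟩
    refine ⟨max τ τ', by positivity, min η η', by positivity, ?_⟩
    rintro x hx u φ hφ
    have hanti := IsForwardSolution.antitoneOn hφ hV fun t => hL (u t)
    have hmax : max τ τ' ∈ Ici (0 : ℝ) := mem_Ici.2 (by positivity)
    rcases hx with hx | hx
    · have h1 := hanti (mem_Ici.2 hτ.le) hmax (le_max_left τ τ')
      have h2 := h x hx u φ hφ
      have := min_le_left η η'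
      simp only at h1
      linarith
    · have h1 := hanti (mem_Ici.2 hτ'.le) hmax (le_max_right τ τ')
      have h2 := h' x hx u φ hφ
      have := min_le_right η η'
      simp only at h1
      linarith
  · intro p hp
    obtain ⟨U, hU, h⟩ := hloc p hp
    exact ⟨U, mem_nhdsWithin_of_mem_nhds hU, h⟩

end Decrease

/-! ### Proper Lyapunov functions and uniform convergence. -/

section Proper

variable {E : Type*} [NormedAddCommGroup E] {V : E → ℝ}

theorem isCompact_sublevel (hV : Continuous V) (hVunb : Tendsto V (cocompact E) atTop) (c : ℝ) :
    IsCompact {x | V x ≤ c} := by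
  obtain ⟨K, hK, hKc⟩ := mem_cocompact.1 (hVunb.eventually (eventually_gt_atTop c))
  refine hK.of_isClosed_subset (isClosed_le hV continuous_const) fun x hx => ?_
  by_contra h
  exact absurd (show c < V x from hKc h) (not_lt.2 hx)

/-- Positivity alone would let `V` approach `0` at infinity; properness gives a positive minimum on
the part of `V ≤ 1` outside the ball. -/
theorem exists_sublevel_subset_ball (hV : Continuous V)
    (hVunb : Tendsto V (cocompact E) atTop) (hpos : ∀ x, x ≠ 0 → 0 < V x) {δ : ℝ} (hδ : 0 < δ) :
    ∃ m : ℝ, 0 < m ∧ ∀ x, V x < m → ‖x‖ < δ := by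
  have hK : IsCompact ({x | V x ≤ 1} ∩ {x | δ ≤ ‖x‖}) :=
    (isCompact_sublevel hV hVunb 1).inter_right (isClosed_le continuous_const continuous_norm)
  rcases ({x | V x ≤ 1} ∩ {x | δ ≤ ‖x‖}).eq_empty_or_nonempty with he | hn
  · refine ⟨1, one_pos, fun x hx => ?_⟩
    by_contra! h
    exact (he ▸ (⟨hx.le, h⟩ : x ∈ {x | V x ≤ 1} ∩ {x | δ ≤ ‖x‖}) : x ∈ (∅ : Set E))
  · obtain ⟨y, hy, hmin⟩ := hK.exists_isMinOn hn hV.continuousOn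
    have hy0 : 0 < V y := hpos y (norm_pos_iff.1 (hδ.trans_le hy.2))
    refine ⟨min 1 (V y), by positivity, fun x hx => ?_⟩
    by_contra! h
    have h1 : V x ≤ 1 := hx.le.trans (min_le_left _ _)
    exact absurd (isMinOn_iff.1 hmin x ⟨h1, h⟩) (not_le.2 (hx.trans_le (min_le_right _ _)))

end Proper

/-- Convergence to the origin is uniform when `V` decreases locally uniformly away from it. -/
theorem isGUAS_of_local_decrease {ι : Type*} {f : ι → Plane → Plane} {V : Plane → ℝ}
    (hcomplete : ∀ i x, ∃ φ : ℝ → Plane, IsForwardSolution (fun _ => f i) x φ)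
    (hV : Differentiable ℝ V) (hLyap : IsWeakLyapunov f V)
    (hVunb : Tendsto V (cocompact Plane) atTop)
    (hloc : ∀ p, p ≠ 0 → ∃ U ∈ 𝓝 p, ∃ τ : ℝ, 0 < τ ∧ ∃ η : ℝ, 0 < η ∧ ∀ x ∈ U,
      ∀ (u : ℝ → ι) (φ : ℝ → Plane), IsTrajectory f u x φ → V (φ τ) ≤ V x - η) :
    IsGUAS f := by
  refine ⟨fun u hu x => exists_isTrajectory hcomplete hu x, fun δ hδ => ?_, fun ε δ hε hδ => ?_⟩
  · obtain ⟨m, hm, hmδ⟩ := exists_sublevel_subset_ball hV.continuous hVunb hLyap.pos hδ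
    have h1 : ∀ᶠ x in 𝓝 (0 : Plane), V x < m :=
      hV.continuous.continuousAt.eventually (Iio_mem_nhds (by rwa [hLyap.zero]))
    obtain ⟨ε, hε, h2⟩ := Metric.nhds_basis_closedBall.mem_iff.1 h1
    refine ⟨ε, hε, fun x hx u _ φ hφ t ht => (hmδ _ ?_).le⟩
    have h3 : V (φ t) ≤ V (φ 0) := hφ.antitoneOn hV hLyap (mem_Ici.2 le_rfl) (mem_Ici.2 ht) ht
    rw [hφ.1] at h3
    exact h3.trans_lt (h2 (mem_closedBall_zero_iff.2 hx))
  · obtain ⟨m, hm, hmε⟩ := exists_sublevel_subset_ball hV.continuous hVunb hLyap.pos hε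
    obtain ⟨M, hM⟩ := (isCompact_closedBall (0 : Plane) δ).bddAbove_image hV.continuous.continuousOn
    have hK : IsCompact {x | V x ≤ M ∧ m ≤ V x} :=
      (isCompact_sublevel hV.continuous hVunb M).inter_right
        (isClosed_le continuous_const hV.continuous)
    obtain ⟨τ, hτ, η, hη, hdec⟩ := exists_decrease_of_isCompact hV hLyap.lie_nonpos hK
      fun p hp => hloc p fun h0 => by
        have := hp.2
        rw [h0, hLyap.zero] at this
        linarith
    obtain ⟨N, hN⟩ := exists_nat_gt (M / η)
    rw [div_lt_iff₀ hη] at hN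
    refine ⟨N * τ + 1, by positivity, fun x hx u _ φ hφ t ht => (hmε _ ?_).le⟩
    have hanti := hφ.antitoneOn hV hLyap
    -- Each time `τ` in the shell costs `η`; as `N * η > M`, the second alternative fails at `N`
    -- because `V ≥ 0`.
    have hstep : ∀ n : ℕ, V (φ (n * τ)) < m ∨ V (φ (n * τ)) ≤ M - n * η := by
      intro n
      induction n with
      | zero =>
        right
        simpa [hφ.1] using hM (mem_image_of_mem V (mem_closedBall_zero_iff.2 hx))
      | succ n ih =>
        have hn : (0 : ℝ) ≤ n * τ := by positivity
        have hle : V (φ ((n + 1 : ℕ) * τ)) ≤ V (φ (n * τ)) :=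
          hanti (mem_Ici.2 hn) (mem_Ici.2 (by positivity)) (by push_cast; linarith)
        by_cases hc : V (φ (n * τ)) < m
        · exact Or.inl (hle.trans_lt hc)
        · right
          have h1 := ih.resolve_left hc
          have h2 : (0 : ℝ) ≤ n * η := by positivity
          -- The estimate holds for arbitrary `u`, so the shifted input need not be checked to be a
          -- switching signal.
          have h3 := hdec (φ (n * τ)) ⟨by linarith, not_lt.1 hc⟩ _ _ (hφ.shift hn)
          have h4 : τ + n * τ = (n + 1 : ℕ) * τ := by push_cast; ring
          simp only [h4] at h3
          push_cast at h3 ⊢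
          linarith
    have hNτ : (0 : ℝ) ≤ N * τ := by positivity
    have h5 : V (φ (N * τ)) < m :=
      (hstep N).resolve_right fun h => by linarith [hLyap.nonneg (φ (N * τ))]
    exact (hanti (mem_Ici.2 hNτ) (mem_Ici.2 (by linarith)) (by linarith)).trans_lt h5

/-! ### Fast switching between opposite fields. -/

/-- A periodic switching signal of period `h`, together with the sawtooth function of slopes `1`
and `-c` that it generates. -/
theorem exists_sawtooth {c h : ℝ} (hc : 0 < c) (hh : 0 < h) :
    ∃ (u : ℝ → Fin 2) (s : ℝ → ℝ), IsSwitchingSignal u ∧ s 0 = 0 ∧ Continuous s ∧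
      (∀ t, |s t| ≤ h) ∧
      ∀ t, HasDerivWithinAt s (if u t = 0 then 1 else -c) (Ici t) t := by
  -- The share of each period spent on field `0`: `l = c * (1 - l)`, so the sawtooth returns to
  -- zero.
  set l : ℝ := c / (1 + c) with hl
  have hl0 : 0 < l := by positivity
  have hl1 : l < 1 := by rw [hl, div_lt_one (by positivity)]; linarith
  have hlc : l * (1 + c) = c := by rw [hl]; field_simp
  let σ : ℝ → ℝ := fun r => min r (c * (1 - r))
  have hσ1 : ∀ r, r ≤ l → σ r = r := fun r hr => min_eq_left (by nlinarith)
  have hσ2 : ∀ r, l ≤ r → σ r = c * (1 - r) := fun r hr => min_eq_right (by nlinarith)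
  have hσc : Continuous σ := by fun_prop
  refine ⟨fun t => if Int.fract (t / h) < l then 0 else 1, fun t => h * σ (Int.fract (t / h)),
    ?_, ?_, ?_, ?_, ?_⟩
  · refine ⟨fun n => h * ((n / 2 : ℕ) + (n % 2 : ℕ) * l), by simp, ?_, ?_, ?_⟩
    · refine strictMono_nat_of_lt_succ fun n => mul_lt_mul_of_pos_left ?_ hh
      rcases Nat.even_or_odd' n with ⟨k, rfl | rfl⟩
      · rw [show (2 * k + 1) / 2 = k by omega, show (2 * k + 1) % 2 = 1 by omega,
          show (2 * k) / 2 = k by omega, show (2 * k) % 2 = 0 by omega]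
        simpa using hl0
      · rw [show (2 * k + 1 + 1) / 2 = k + 1 by omega, show (2 * k + 1 + 1) % 2 = 0 by omega,
          show (2 * k + 1) / 2 = k by omega, show (2 * k + 1) % 2 = 1 by omega]
        push_cast
        linarith
    · refine Tendsto.const_mul_atTop hh ?_
      refine tendsto_atTop_mono (fun n => le_add_of_nonneg_right (by positivity)) ?_
      exact tendsto_natCast_atTop_atTop.comp (Nat.tendsto_div_const_atTop two_ne_zero)
    · intro n t ht
      have ht1 := (le_div_iff₀' hh).2 ht.1
      have ht2 := (div_lt_iff₀' hh).2 ht.2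
      rcases Nat.even_or_odd' n with ⟨k, rfl | rfl⟩
      · rw [show (2 * k) / 2 = k by omega, show (2 * k) % 2 = 0 by omega] at ht1
        rw [show (2 * k + 1) / 2 = k by omega, show (2 * k + 1) % 2 = 1 by omega] at ht2
        beta_reduce
        rw [show (2 * k) / 2 = k by omega, show (2 * k) % 2 = 0 by omega]
        simp only [Nat.cast_zero, zero_mul, add_zero, Nat.cast_one, one_mul] at ht1 ht2 ⊢
        have h1 : Int.fract (t / h) = t / h - k :=
          Int.fract_eq_iff.2 ⟨by linarith, by linarith, k, by push_cast; ring⟩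
        rw [if_pos (by linarith), mul_div_cancel_left₀ _ hh.ne', Int.fract_natCast, if_pos hl0]
      · rw [show (2 * k + 1) / 2 = k by omega, show (2 * k + 1) % 2 = 1 by omega] at ht1
        rw [show (2 * k + 1 + 1) / 2 = k + 1 by omega,
          show (2 * k + 1 + 1) % 2 = 0 by omega] at ht2
        beta_reduce
        rw [show (2 * k + 1) / 2 = k by omega, show (2 * k + 1) % 2 = 1 by omega]
        push_cast at ht1 ht2 ⊢
        have h1 : Int.fract (t / h) = t / h - k :=
          Int.fract_eq_iff.2 ⟨by linarith, by linarith, k, by push_cast; ring⟩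
        have h2 : Int.fract ((k : ℝ) + 1 * l) = l :=
          Int.fract_eq_iff.2 ⟨hl0.le, hl1, k, by push_cast; ring⟩
        rw [if_neg (by linarith), mul_div_cancel_left₀ _ hh.ne', h2, if_neg (lt_irrefl _)]
  · simp [σ, hc.le]
  · have h1 : Continuous fun r : ℝ => σ (Int.fract r) :=
      hσc.continuousOn.comp_fract'' (by simp [σ, hc.le])
    exact continuous_const.mul (h1.comp (continuous_id.div_const h))
  · intro t
    have h0 := Int.fract_nonneg (t / h)
    have h1 := Int.fract_lt_one (t / h)
    have h2 : 0 ≤ σ (Int.fract (t / h)) := le_min h0 (mul_nonneg hc.le (by linarith))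
    have h3 : σ (Int.fract (t / h)) ≤ 1 := (min_le_left _ _).trans h1.le
    rw [abs_of_nonneg (by positivity)]
    nlinarith
  · intro t
    set k : ℤ := ⌊t / h⌋ with hk
    have hfr : ∀ r, h * k ≤ r → r < h * (k + 1) → Int.fract (r / h) = r / h - k := by
      intro r h1 h2
      have h3 := (le_div_iff₀' hh).2 h1
      have h4 := (div_lt_iff₀' hh).2 h2
      exact Int.fract_eq_iff.2 ⟨by linarith, by linarith, k, by ring⟩
    have ht1 : h * k ≤ t := (le_div_iff₀' hh).1 (Int.floor_le _)
    have ht2 : t < h * (k + 1) := (div_lt_iff₀' hh).1 (Int.lt_floor_add_one _)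
    have hft := hfr t ht1 ht2
    by_cases hlt : Int.fract (t / h) < l
    · have ht3 : t < h * (k + l) := by
        rw [hft] at hlt
        exact (div_lt_iff₀' hh).1 (by linarith)
      have hs : ∀ r, h * k ≤ r → r < h * (k + l) → h * σ (Int.fract (r / h)) = r - h * k := by
        intro r h1 h2
        have h3 := (div_lt_iff₀' hh).2 h2
        rw [hfr r h1 (h2.trans (mul_lt_mul_of_pos_left (by linarith) hh)), hσ1 _ (by linarith),
          mul_sub, mul_div_cancel₀ _ hh.ne']
      simp only [hlt, if_true]
      refine ((hasDerivAt_id t).sub_const (h * k)).hasDerivWithinAt.congr_of_eventuallyEq ?_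
        (hs t ht1 ht3)
      filter_upwards [self_mem_nhdsWithin, nhdsWithin_le_nhds (Iio_mem_nhds ht3)] with r h1 h2
      exact hs r (ht1.trans h1) h2
    · have ht3 : h * (k + l) ≤ t := by
        rw [hft, not_lt] at hlt
        exact (le_div_iff₀' hh).1 (by linarith)
      have hs : ∀ r, h * (k + l) ≤ r → r < h * (k + 1) →
          h * σ (Int.fract (r / h)) = -c * r + h * c * (k + 1) := by
        intro r h1 h2
        have h3 := (le_div_iff₀' hh).2 h1
        rw [hfr r (le_trans (mul_le_mul_of_nonneg_left (by linarith) hh.le) h1) h2,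
          hσ2 _ (by linarith)]
        field_simp
        ring
      have h10 : (if (if Int.fract (t / h) < l then (0 : Fin 2) else 1) = 0 then (1 : ℝ) else -c)
          = -c := by simp [hlt]
      rw [h10]
      have hd : HasDerivAt (fun r => -c * r + h * c * (k + 1)) (-c) t := by
        simpa using ((hasDerivAt_id t).const_mul (-c)).add_const (h * c * (k + 1))
      refine hd.hasDerivWithinAt.congr_of_eventuallyEq ?_ (hs t ht3 ht2)
      filter_upwards [self_mem_nhdsWithin, nhdsWithin_le_nhds (Iio_mem_nhds ht2)] with r h1 h2
      exact hs r (ht3.trans h1) h2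

/-- At a point where the two vector fields are opposite, fast switching produces trajectories that
stay arbitrarily close to that point. -/
theorem exists_trajectory_near {E : Type*} [NormedAddCommGroup E] [NormedSpace ℝ E]
    {f : Fin 2 → E → E}
    (hcomplete : ∀ u : ℝ → Fin 2, IsSwitchingSignal u → ∀ x : E, ∃ φ : ℝ → E, IsTrajectory f u x φ)
    {x : E} {c : ℝ} (hc : 0 < c) (hx : f 1 x = -c • f 0 x) {S : Set E} {K : NNReal}
    (hLip : ∀ i, LipschitzOnWith K (f i) S)
    (hS : ∀ u φ, IsTrajectory f u x φ → ∀ t, 0 ≤ t → φ t ∈ S) {T ε : ℝ} (hT : 0 ≤ T)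
    (hε : 0 < ε) :
    ∃ u : ℝ → Fin 2, IsSwitchingSignal u ∧ ∃ φ : ℝ → E, IsTrajectory f u x φ ∧
      ‖φ T - x‖ < ε := by
  set v := f 0 x with hv
  obtain ⟨h, hhε, hh⟩ : ∃ h : ℝ, gronwallBound 0 K (K * (h * ‖v‖)) T + h * ‖v‖ < ε ∧ 0 < h := by
    have hcont : Continuous fun h : ℝ => gronwallBound 0 K (K * (h * ‖v‖)) T + h * ‖v‖ :=
      ((gronwallBound_continuous_ε 0 K T).comp (by fun_prop)).add (by fun_prop)
    have hlim := hcont.tendsto 0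
    simp only [zero_mul, mul_zero, gronwallBound_ε0_δ0, add_zero] at hlim
    exact (((hlim.eventually (Iio_mem_nhds hε)).filter_mono
      (nhdsWithin_le_nhds (s := Ioi 0))).and self_mem_nhdsWithin).exists
  obtain ⟨u, s, hu, hs0, hsc, hsb, hsd⟩ := exists_sawtooth hc hh
  obtain ⟨φ, hφ⟩ := hcomplete u hu x
  refine ⟨u, hu, φ, hφ, ?_⟩
  have hxS : x ∈ S := by simpa [hφ.1] using hS u φ hφ 0 le_rfl
  have hfx : ∀ t, f (u t) x = (if u t = 0 then (1 : ℝ) else -c) • v := by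
    intro t
    generalize u t = i
    fin_cases i
    · simp [hv]
    · simpa using hx
  have hsv : ∀ t, ‖s t • v‖ ≤ h * ‖v‖ := fun t => by
    rw [norm_smul]
    exact mul_le_mul_of_nonneg_right (hsb t) (norm_nonneg v)
  -- The sawtooth path `x + s t • v` follows the fields frozen at `x`. The deviation of `φ` from it
  -- grows at rate at most `K` times itself plus `K * (h * ‖v‖)`.
  have hψ := norm_le_gronwallBound_of_norm_deriv_right_le (f := fun t => φ t - s t • v - x)
    (f' := fun t => f (u t) (φ t) - (if u t = 0 then (1 : ℝ) else -c) • v) (δ := 0) (K := K)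
    (ε := K * (h * ‖v‖)) (a := 0) (b := T)
    (((hφ.2.1.mono fun t ht => ht.1).sub (hsc.smul continuous_const).continuousOn).sub
      continuousOn_const)
    (fun t ht => ((hφ.2.2 t ht.1).sub ((hsd t).smul_const v)).sub_const x)
    (by simp [hφ.1, hs0]) (fun t ht => ?_) T (right_mem_Icc.2 hT)
  · calc ‖φ T - x‖ = ‖(φ T - s T • v - x) + s T • v‖ := by congr 1; abel
      _ ≤ gronwallBound 0 K (K * (h * ‖v‖)) T + h * ‖v‖ := by
        rw [sub_zero] at hψ
        exact (norm_add_le _ _).trans (add_le_add hψ (hsv T))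
      _ < ε := hhε
  · rw [← hfx t, ← mul_add]
    have h1 := (hLip (u t)).norm_sub_le (hS u φ hφ t ht.1) hxS
    refine h1.trans (mul_le_mul_of_nonneg_left ?_ K.2)
    calc ‖φ t - x‖ = ‖(φ t - s t • v - x) + s t • v‖ := by congr 1; abel
      _ ≤ _ := (norm_add_le _ _).trans (by gcongr; exact hsv t)

/-! ### Planar linear algebra. -/

theorem exists_eq_neg_smul_of_collinear {g h : Plane → Plane} {x : Plane}
    (hx : x ∈ collinearSet g h) (hneg : inner ℝ (g x) (h x) < 0) :
    ∃ c : ℝ, 0 < c ∧ h x = -c • g x := by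
  have hdet : g x 0 * h x 1 - h x 0 * g x 1 = 0 := by
    simpa [collinearSet, Matrix.det_fin_two] using hx
  have hin : inner ℝ (g x) (h x) = g x 0 * h x 0 + g x 1 * h x 1 := by
    simp [PiLp.inner_apply, Fin.sum_univ_two, mul_comm]
  rw [hin] at hneg
  have hpos : 0 < g x 0 ^ 2 + g x 1 ^ 2 := by
    by_contra hle
    have h0 : g x 0 = 0 := by nlinarith [sq_nonneg (g x 0), sq_nonneg (g x 1)]
    have h1 : g x 1 = 0 := by nlinarith [sq_nonneg (g x 0), sq_nonneg (g x 1)]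
    simp [h0, h1] at hneg
  refine ⟨-(g x 0 * h x 0 + g x 1 * h x 1) / (g x 0 ^ 2 + g x 1 ^ 2),
    div_pos (neg_pos.2 hneg) hpos, ?_⟩
  have hne := hpos.ne'
  ext i
  fin_cases i
  · simp only [Fin.zero_eta, PiLp.smul_apply, smul_eq_mul]
    field_simp
    linear_combination (-g x 1) * hdet
  · simp only [Fin.mk_one, PiLp.smul_apply, smul_eq_mul]
    field_simp
    linear_combination (g x 0) * hdet

/-- Two nonzero planar vectors that are not opposite lie in a common open half-plane. -/
theorem exists_inner_pos {a b : Plane} (ha : a ≠ 0) (hb : b ≠ 0)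
    (hab : Matrix.det !![a 0, b 0; a 1, b 1] = 0 → 0 ≤ inner ℝ a b) :
    ∃ w : Plane, 0 < inner ℝ w a ∧ 0 < inner ℝ w b := by
  have hna := norm_pos_iff.2 ha
  have hnb := norm_pos_iff.2 hb
  -- Lagrange's identity: the squared determinant is `‖a‖ ^ 2 * ‖b‖ ^ 2 - (inner ℝ a b) ^ 2`.
  have key : 0 < ‖a‖ * ‖b‖ + inner ℝ a b := by
    by_contra! hle
    have hmul := mul_pos hna hnb
    have hin : inner ℝ a b = a 0 * b 0 + a 1 * b 1 := by
      simp [PiLp.inner_apply, Fin.sum_univ_two, mul_comm]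
    have hsa : ‖a‖ ^ 2 = a 0 ^ 2 + a 1 ^ 2 := by
      simp [EuclideanSpace.norm_sq_eq, Fin.sum_univ_two]
    have hsb : ‖b‖ ^ 2 = b 0 ^ 2 + b 1 ^ 2 := by
      simp [EuclideanSpace.norm_sq_eq, Fin.sum_univ_two]
    have hneg : inner ℝ a b < 0 := by linarith
    refine absurd (hab ?_) (not_le.2 hneg)
    rw [Matrix.det_fin_two_of]
    have h1 : (‖a‖ * ‖b‖) ^ 2 ≤ (inner ℝ a b) ^ 2 := by nlinarith
    rw [mul_pow, hsa, hsb, hin] at h1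
    have h2 : (a 0 * b 1 - b 0 * a 1) ^ 2 ≤ 0 := by nlinarith
    exact pow_eq_zero_iff two_ne_zero |>.1 (le_antisymm h2 (sq_nonneg _))
  -- The angle bisector; its products with `a` and `b` are `‖a‖` and `‖b‖` times the quantity in
  -- `key`.
  refine ⟨‖b‖ • a + ‖a‖ • b, ?_, ?_⟩
  · rw [inner_add_left, real_inner_smul_left, real_inner_smul_left, real_inner_self_eq_norm_sq,
      real_inner_comm]
    nlinarith [mul_pos hna key]
  · rw [inner_add_left, real_inner_smul_left, real_inner_smul_left, real_inner_self_eq_norm_sq]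
    nlinarith [mul_pos hnb key]

/-- Two vectors in the kernel of a nonzero linear form on the plane are collinear. -/
theorem det_eq_zero_of_apply_eq_zero {D : Plane →L[ℝ] ℝ} (hD : D ≠ 0) {a b : Plane}
    (ha : D a = 0) (hb : D b = 0) : Matrix.det !![a 0, b 0; a 1, b 1] = 0 := by
  rw [Matrix.det_fin_two_of]
  by_contra hdet
  refine hD (ContinuousLinearMap.ext fun v => ?_)
  -- Cramer's rule for `v` in terms of `a` and `b`.
  have hv : (a 0 * b 1 - b 0 * a 1) • v =
      (v 0 * b 1 - b 0 * v 1) • a + (a 0 * v 1 - v 0 * a 1) • b := by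
    ext i
    fin_cases i
    · simp
      ring
    · simp
      ring
  have := congrArg D hv
  simp only [map_smul, map_add, ha, hb, smul_zero, add_zero] at this
  simpa using (smul_eq_zero.1 this).resolve_left hdet

end Switched

/-! ### The equivalence. -/

theorem mainTheorem6
    (f : Fin 2 → Switched.Plane → Switched.Plane) (V : Switched.Plane → ℝ)
    (hf : ∀ i, AnalyticOnNhd ℝ (f i) Set.univ)
    (hf0 : ∀ i, f i 0 = 0)
    (hGAS : ∀ i, Switched.IsGAS (f i))
    (hV : AnalyticOnNhd ℝ V Set.univ)
    (hLyap : Switched.IsWeakLyapunov f V)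
    (hVunb : Filter.Tendsto V (Filter.cocompact Switched.Plane) Filter.atTop)
    (hdV : ∀ x, fderiv ℝ V x = 0 → x = 0) :
    List.TFAE
      [Switched.IsGUAS f,
       {x | x ∈ Switched.collinearSet (f 0) (f 1) ∧ inner ℝ (f 0 x) (f 1 x) < 0} = ∅,
       {x | x ∈ Switched.tangencySet (f 0) V ∩ Switched.tangencySet (f 1) V ∧
          inner ℝ (f 0 x) (f 1 x) < 0} = ∅] := by
  have hVc : ContDiff ℝ 1 V := contDiff_iff_contDiffAt.2 fun x => (hV x (mem_univ x)).contDiffAt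
  have hfc : ∀ i, ContDiff ℝ 1 (f i) := fun i =>
    contDiff_iff_contDiffAt.2 fun x => (hf i x (mem_univ x)).contDiffAt
  have hVd : Differentiable ℝ V := hVc.differentiable one_ne_zero
  tfae_have 1 → 2 := by
    intro hG
    refine eq_empty_of_forall_notMem fun x hx => ?_
    obtain ⟨c, hc, hcx⟩ := Switched.exists_eq_neg_smul_of_collinear hx.1 hx.2
    have hx0 : x ≠ 0 := by
      rintro rfl
      simp [hf0] at hx
    have hxn := norm_pos_iff.2 hx0
    -- This set is invariant under every input, so one Lipschitz constant on it serves all switching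
    -- frequencies.
    have hS : IsCompact {y | V y ≤ V x} := Switched.isCompact_sublevel hVd.continuous hVunb _
    have hLip : ∀ i, ∃ K, LipschitzOnWith K (f i) {y | V y ≤ V x} := fun i =>
      (hfc i).locallyLipschitz.locallyLipschitzOn.exists_lipschitzOnWith_of_compact hS
    choose K hK using hLip
    obtain ⟨T, hT, hTx⟩ := hG.attractive (‖x‖ / 2) ‖x‖ (by positivity) hxn
    obtain ⟨u, hu, φ, hφ, hφT⟩ := Switched.exists_trajectory_near hG.complete hc hcx
      (S := {y | V y ≤ V x}) (K := max (K 0) (K 1))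
      (fun i => (hK i).weaken (by fin_cases i <;> simp))
      (fun u φ hφ t ht => by
        have : V (φ t) ≤ V (φ 0) :=
          hφ.antitoneOn hVd hLyap (mem_Ici.2 le_rfl) (mem_Ici.2 ht) ht
        rwa [hφ.1] at this) hT.le (half_pos hxn)
    have h1 := hTx x le_rfl u hu φ hφ T le_rfl
    have h2 := norm_sub_norm_le x (φ T)
    rw [norm_sub_rev] at h2
    linarith
  tfae_have 2 → 1 := by
    intro hE
    refine Switched.isGUAS_of_local_decrease (fun i => (hGAS i).complete) hVd hLyap hVunb
      fun p hp => ?_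
    obtain ⟨w, hw0, hw1⟩ := Switched.exists_inner_pos ((hGAS 0).ne_zero hp) ((hGAS 1).ne_zero hp)
      fun hdet => not_lt.1 fun hlt => eq_empty_iff_forall_notMem.1 hE p ⟨hdet, hlt⟩
    refine Switched.exists_local_decrease (fun i => (hfc i).continuous) hVc hLyap.lie_nonpos
      (Fin.forall_fin_two.2 ⟨hw0, hw1⟩) fun i => ?_
    exact Switched.eventually_lieDeriv_ne_zero (hf i) (hGAS i) hV hLyap.zero hLyap.pos
      (hLyap.lie_nonpos i) hdV hp
  tfae_have 2 → 3 := by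
    intro hE
    refine eq_empty_of_forall_notMem fun x hx => ?_
    have hx0 : x ≠ 0 := by
      rintro rfl
      simp [hf0] at hx
    exact eq_empty_iff_forall_notMem.1 hE x
      ⟨Switched.det_eq_zero_of_apply_eq_zero (mt (hdV x) hx0) hx.1.1 hx.1.2, hx.2⟩
  tfae_have 3 → 2 := by
    intro hE
    refine eq_empty_of_forall_notMem fun x hx => ?_
    obtain ⟨c, hc, hcx⟩ := Switched.exists_eq_neg_smul_of_collinear hx.1 hx.2
    have h0 := hLyap.lie_nonpos 0 x
    have h1 := hLyap.lie_nonpos 1 x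
    simp only [Switched.lieDeriv] at h0 h1
    rw [hcx, map_smul, smul_eq_mul] at h1
    -- This number and its product with `-c` are both nonpositive.
    have h2 : fderiv ℝ V x (f 0 x) = 0 := by nlinarith
    refine eq_empty_iff_forall_notMem.1 hE x ⟨⟨h2, ?_⟩, hx.2⟩
    change fderiv ℝ V x (f 1 x) = 0
    rw [hcx, map_smul, h2, smul_zero]
  tfae_finish
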